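/- A graph is a pair $(V,E)$ with $E\subseteq[V]^2$; $G[v]$ denotes the set of neighbours of a vertex $v$ in $G$. A ray in a graph is a subgraph that is a one-way infinite path; a tail of a ray $R$ is an infinite connected subgraph of $R$; two rays are tail-equivalent if they share a common tail. Let $\mathcal G$ be the class of all graphs $G$ such that for every vertex $v$ of $G$ the subgraph of $G$ induced on $G[v]$ contains at most one ray up to tail-equivalence. For a cardinal $\lambda$ let $\mathcal G_\lambda$ be the set of isomorphism types of graphs in $\mathcal G$ with exactly $\lambda$ vertices, and let the complexity $\mathrm{cp}\,\mathcal G_\lambda$ be the least cardinality of a subset $D\subseteq\mathcal G_\lambda$ such that every $G\in\mathcal G_\lambda$ is isomorphic to an induced subgraph of some $G'\in D$. **Corollary 2.5.** For every regular cardinal $\lambda>\aleph_1$, $$\mathrm{cp}\,\mathcal G_\lambda\ \ge\ \sup\bigl(\{\lambda^+\}\cup\{\mu^{\aleph_0} : \mu \text{ a cardinal},\ \mu^+<\lambda\}\bigr).$$ -/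

import Mathlib

open Cardinal

universe u

namespace SimpleGraph

/-- A ray in `G` is a subgraph of `G` that is a 1-way infinite path, i.e. is isomorphic to the
graph on `ℕ` in which exactly the consecutive numbers are adjacent. -/
def Subgraph.IsRay {V : Type u} {G : SimpleGraph V} (R : G.Subgraph) : Prop :=
  Nonempty (hasse ℕ ≃g R.coe)

/-- A tail of a ray `R` is an infinite connected subgraph of `R`. -/
def Subgraph.IsTailOf {V : Type u} {G : SimpleGraph V} (T R : G.Subgraph) : Prop :=
  T ≤ R ∧ T.verts.Infinite ∧ T.Connected

/-- Two rays are tail-equivalent if they share a common tail. -/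
def Subgraph.TailEquivalent {V : Type u} {G : SimpleGraph V} (R₁ R₂ : G.Subgraph) : Prop :=
  ∃ T : G.Subgraph, T.IsTailOf R₁ ∧ T.IsTailOf R₂

/-- The class `𝒢` of all graphs `G` such that for every vertex `v` the subgraph of `G` induced on
the neighbourhood of `v` has at most one ray up to tail-equivalence. -/
def InClassG {V : Type u} (G : SimpleGraph V) : Prop :=
  ∀ v : V, ∀ R₁ R₂ : (G.induce (G.neighborSet v)).Subgraph,
    R₁.IsRay → R₂.IsRay → R₁.TailEquivalent R₂

/-- Isomorphism of graphs on the vertex set `V`. -/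
def isoSetoid (V : Type u) : Setoid (SimpleGraph V) where
  r G H := Nonempty (G ≃g H)
  iseqv :=
    { refl := fun _ => ⟨Iso.refl⟩
      symm := fun ⟨e⟩ => ⟨e.symm⟩
      trans := fun ⟨e⟩ ⟨f⟩ => ⟨f.comp e⟩ }

/-- The isomorphism types of graphs of cardinality `κ`. Every graph with `κ` vertices is isomorphic
to one on the vertex set `κ.out`, a fixed type of cardinality `κ`. -/
def IsoType (κ : Cardinal.{u}) : Type u :=
  Quotient (isoSetoid κ.out)

/-- The isomorphism type of a graph on `κ.out`. -/
def isoType {κ : Cardinal.{u}} (G : SimpleGraph κ.out) : IsoType κ :=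
  Quotient.mk (isoSetoid κ.out) G

/-- The relation `≤` on isomorphism types: `s ≤ t` if a graph of type `s` is isomorphic to an
induced subgraph of a graph of type `t`. -/
def IsoType.Embeds {κ : Cardinal.{u}} (s t : IsoType κ) : Prop :=
  ∃ G H : SimpleGraph κ.out, isoType G = s ∧ isoType H = t ∧ Nonempty (G ↪g H)

/-- The set `𝒢_κ` of isomorphism types of members of `𝒢` of cardinality `κ`. -/
def classG (κ : Cardinal.{u}) : Set (IsoType κ) :=
  {t | ∃ G : SimpleGraph κ.out, G.InClassG ∧ isoType G = t}

/-- The complexity of a set `A` of isomorphism types: the least cardinality of a subset `D` of `A`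
such that every member of `A` embeds as an induced subgraph into some member of `D`.
The set of cardinals in question is nonempty since `D = A` qualifies. -/
noncomputable def complexity {κ : Cardinal.{u}} (A : Set (IsoType κ)) : Cardinal.{u} :=
  sInf {c | ∃ D : Set (IsoType κ), D ⊆ A ∧ (∀ s ∈ A, ∃ t ∈ D, s.Embeds t) ∧ #D = c}

end SimpleGraph

/-! Both bounds come from diagonalisation: against too few graphs `H i` of the class on `κ`
vertices, one builds a graph `G` of the class, with at most `κ` vertices, that embeds in none of
them (`le_complexity_classG`).

For `κ⁺`: two rays in one neighbourhood meet, so a countable set hits all rays of that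
neighbourhood, and the finite paths avoiding it form a well-founded tree. `G` is a cone over the
tree of descending sequences of such paths, each path taken in `κ` copies. An embedding into `H i`
would map this tree into the path tree of one neighbourhood, against a rank comparison
(`isEmpty_chainCone_embedding`).

For `μ ^ ℵ₀`: only infinite `μ` with `κ < μ ^ ℵ₀` matters. Club guessing gives at most `κ` codings
of the finite sequences over a set `M` of size `μ` by points of `κ`, such that every club contains
the range of one of them (`exists_guessing_treeCodes`). `G` is the tree of finite sequences in `κ`
with, for each coding, an apex over the coded branch of one fixed `f : ℕ → M`. An embedding respects
positions relative to a club (`exists_forall_closurePoints_lt_iff`), so above some apex the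
positions of the image ray spell out `f`. A graph `H k`, a vertex and a coding determine at most one
such `f` (`InClassG.branch_unique`); hence fewer than `μ ^ ℵ₀` are spelled out, and `f` is chosen
outside them. -/

open Set in
/-- The cofinality and cardinality properties of a regular cardinal `κ`, seen as a well-order. -/
structure IsRegularOrder (K : Type u) [LinearOrder K] (κ : Cardinal.{u}) : Prop where
  exists_gt : ∀ s : Set K, #s < κ → ∃ b, ∀ x ∈ s, x < b
  mk_Iio_lt : ∀ b : K, #(Iio b) < κ

theorem isRegularOrder_toType {κ : Cardinal.{u}} (hκ : κ.IsRegular) :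
    IsRegularOrder κ.ord.ToType κ where
  exists_gt s hs := by
    by_contra! h
    have h1 : Order.cof κ.ord.ToType ≤ #s := Order.cof_le fun x => h x
    rw [Ordinal.cof_toType, hκ.cof_ord] at h1
    exact absurd hs (not_lt.2 h1)
  mk_Iio_lt b := by
    simpa using Cardinal.mk_Iio_lt b (by simp)

/-- The closed sets of ordinals given by closure under a function. -/
def closurePoints {K : Type u} [LinearOrder K] (g : K → K) : Set K := {α | ∀ β < α, g β < α}

theorem closurePoints_antitone {K : Type u} [LinearOrder K] : Antitone (closurePoints (K := K)) :=
  fun _ _ h _ hα β hβ => (h β).trans_lt (hα β hβ)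

/-! ### Clubs and club guessing in a regular cardinal. -/

section
variable {K : Type u} [LinearOrder K] [WellFoundedLT K]

theorem exists_least_gt {s : Set K} (h : ∃ b, ∀ x ∈ s, x < b) :
    ∃ b, (∀ x ∈ s, x < b) ∧ ∀ y < b, ∃ x ∈ s, y ≤ x := by
  obtain ⟨b, hb, hmin⟩ := WellFounded.has_min (wellFounded_lt (α := K)) {b | ∀ x ∈ s, x < b} h
  refine ⟨b, hb, fun y hy => ?_⟩
  by_contra! hc
  exact hmin y hc hy

/-- Closure points form a closed set, so the least upper bound of those below `α` is again one. This
projection to a club drives the guessing argument. -/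
theorem exists_greatest_closurePoint (g : K → K) (α : K) :
    ∃ p, IsGreatest {q | q ∈ closurePoints g ∧ q ≤ α} p := by
  obtain ⟨p, hp, hmin⟩ := WellFounded.has_min (wellFounded_lt (α := K))
    {b | ∀ q ∈ closurePoints g, q ≤ α → q ≤ b} ⟨α, fun q _ hq => hq⟩
  refine ⟨p, ⟨fun β hβ => ?_, not_lt.1 fun h => hmin α (fun q _ hq => hq) h⟩, fun q hq => hp q hq.1 hq.2⟩
  have : ¬ ∀ q ∈ closurePoints g, q ≤ α → q ≤ β := fun h => hmin β h hβ
  push Not at this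
  obtain ⟨q, hq, hqα, hβq⟩ := this
  exact (hq β hβq).trans_le (hp q hq hqα)

theorem IsRegularOrder.exists_closurePoint_gt {κ : Cardinal.{u}} (hK : IsRegularOrder K κ)
    (hκ : ℵ₀ < κ) (g : K → K) (x : K) : ∃ α ∈ closurePoints g, x < α := by
  have step (x : K) : ∃ y, x < y ∧ ∀ β ≤ x, g β < y := by
    obtain ⟨b, hb⟩ := hK.exists_gt (insert x (insert (g x) (g '' Set.Iio x))) <| by
      refine (mk_insert_le.trans (add_le_add_left (mk_insert_le.trans
        (add_le_add_left mk_image_le _)) _)).trans_lt ?_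
      exact add_lt_of_lt hκ.le (add_lt_of_lt hκ.le (hK.mk_Iio_lt x) (one_lt_aleph0.trans hκ))
        (one_lt_aleph0.trans hκ)
    refine ⟨b, hb x (by simp), fun β hβ => hb _ ?_⟩
    rcases hβ.eq_or_lt with rfl | h
    · simp
    · exact Or.inr (Or.inr ⟨β, h, rfl⟩)
  choose F hF hgF using step
  obtain ⟨α, hα, hmin⟩ := exists_least_gt (hK.exists_gt (Set.range fun n => F^[n] x)
    ((mk_le_aleph0_iff.2 (Set.countable_range _).to_subtype).trans_lt hκ))
  refine ⟨α, fun β hβ => ?_, hα x ⟨0, rfl⟩⟩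
  obtain ⟨_, ⟨n, rfl⟩, hn⟩ := hmin β hβ
  refine (hgF _ β hn).trans (hα _ ⟨n + 1, ?_⟩)
  simp only [Function.iterate_succ_apply']

theorem exists_wellFounded_recursion {α : Type*} (F : (j : K) → (Set.Iio j → α) → α) :
    ∃ x : K → α, ∀ j, x j = F j fun i => x i :=
  ⟨(wellFounded_lt (α := K)).fix fun j rec => F j fun i => rec i.1 i.2,
    fun j => WellFounded.fix_eq _ _ j⟩

/-- A family, indexed by `K × J`, of small sets meeting each closed unbounded set in a large set. -/
theorem exists_small_sets {J : Type u} [LinearOrder J] [WellFoundedLT J] {κ ν : Cardinal.{u}}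
    (hK : IsRegularOrder K κ) (hJ : IsRegularOrder J ν) (hJν : #J = ν) (hν : ℵ₀ < ν) (hνκ : ν < κ) :
    ∃ c : K × J → Set K, (∀ i, #(c i) < ν) ∧ ∀ g : K → K, ∃ δ, ∃ X ⊆ closurePoints g, ν ≤ #X ∧
      ∀ Y ⊆ X, #Y < ν → ∃ j, Y ⊆ c (δ, j) := by
  -- `c` is cofinal in `δ` of type `ν`; `e δ` will be its continuous version, chosen before `g` is
  -- known.
  let P (δ : K) (c : J → K) : Prop := StrictMono c ∧ (∀ j, c j < δ) ∧ ∀ y < δ, ∃ j, y ≤ c j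
  have he (δ : K) : ∃ e : J → K, (∃ c, P δ c) → ∃ c, P δ c ∧
      ∀ j, (∀ i < j, c i < e j) ∧ (∀ y < e j, ∃ i < j, y ≤ c i) := by
    by_cases h : ∃ c, P δ c
    · obtain ⟨c, hc⟩ := h
      have (j : J) := exists_least_gt (s := c '' Set.Iio j) ⟨c j, by
        rintro _ ⟨i, hi, rfl⟩; exact hc.1 hi⟩
      choose e he he' using this
      refine ⟨e, fun _ => ⟨c, hc, fun j => ⟨fun i hi => he j _ ⟨i, hi, rfl⟩, fun y hy => ?_⟩⟩⟩
      obtain ⟨_, ⟨i, hi, rfl⟩, h⟩ := he' j y hy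
      exact ⟨i, hi, h⟩
    · exact ⟨fun _ => δ, fun h' => absurd h' h⟩
  choose e he using he
  have gtJ (j : J) : ∃ k, j < k := by
    obtain ⟨k, hk⟩ := hJ.exists_gt {j} (by simpa using one_lt_aleph0.trans hν)
    exact ⟨k, hk j rfl⟩
  refine ⟨fun i => e i.1 '' Set.Iio i.2, fun i => mk_image_le.trans_lt (hJ.mk_Iio_lt _), fun g => ?_⟩
  have hG (s : Set K) : ∃ b, #s < κ → b ∈ closurePoints g ∧ ∀ y ∈ s, y < b := by
    by_cases h : #s < κ
    · obtain ⟨b, hb⟩ := hK.exists_gt s h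
      obtain ⟨α, hα, hbα⟩ := hK.exists_closurePoint_gt (hν.trans hνκ) g b
      exact ⟨α, fun _ => ⟨hα, fun y hy => (hb y hy).trans hbα⟩⟩
    · obtain ⟨b, -⟩ := hK.exists_gt ∅ (by simpa using (aleph0_pos.trans (hν.trans hνκ)))
      exact ⟨b, fun h' => absurd h' h⟩
  choose G hG using hG
  obtain ⟨x, hx⟩ := exists_wellFounded_recursion (K := J) fun j f => G (Set.range f)
  have hx' (j : J) : x j ∈ closurePoints g ∧ ∀ i < j, x i < x j := by
    rw [hx j]
    have := hG (Set.range fun i : Set.Iio j => x i)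
      (mk_range_le.trans_lt ((hJ.mk_Iio_lt j).trans hνκ))
    exact ⟨this.1, fun i hi => this.2 _ ⟨⟨i, hi⟩, rfl⟩⟩
  obtain ⟨δ, hδ, hδ'⟩ := exists_least_gt (hK.exists_gt (Set.range x)
    (mk_range_le.trans_lt (hJν.trans_lt hνκ)))
  obtain ⟨c, ⟨hcm, hcδ, hδc⟩, hc⟩ := he δ ⟨x, fun i j h => (hx' j).2 i h, fun j => hδ _ ⟨j, rfl⟩,
    fun y hy => by obtain ⟨_, ⟨j, rfl⟩, h⟩ := hδ' y hy; exact ⟨j, h⟩⟩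
  have hh (j : J) : ∃ j', ∃ k, c j < x k ∧ x k < c j' := by
    obtain ⟨_, ⟨k, rfl⟩, hk⟩ := hδ' _ (hcδ j)
    obtain ⟨k', hk'⟩ := gtJ k
    obtain ⟨j', hj'⟩ := hδc (x k') (hδ _ ⟨k', rfl⟩)
    obtain ⟨j'', hj''⟩ := gtJ j'
    exact ⟨j'', k', hk.trans_lt ((hx' k').2 _ hk'), hj'.trans_lt (hcm hj'')⟩
  choose h k hk hk' using hh
  refine ⟨δ, Set.range (e δ) ∩ closurePoints g, Set.inter_subset_right, ?_, fun Y hY hYν => ?_⟩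
  · by_contra! hX
    have : ∀ y : ↥(Set.range (e δ) ∩ closurePoints g), ∃ j, e δ j = y := fun y => y.2.1
    choose jy hjy using this
    obtain ⟨j₀, hj₀⟩ := hJ.exists_gt (Set.range jy) (mk_range_le.trans_lt hX)
    obtain ⟨j, hj, hjj⟩ := hJ.exists_closurePoint_gt hν h j₀
    -- As `j` is closed under `h`, the points `x k` interleave with `c` below `j`, so `e δ j` is a
    -- limit of closure points of `g`.
    have hmem : e δ j ∈ closurePoints g := fun β hβ => by
      obtain ⟨i, hi, hβi⟩ := (hc j).2 β hβ
      exact ((hx' (k i)).1 β (hβi.trans_lt (hk i))).trans ((hk' i).trans ((hc j).1 _ (hj i hi)))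
    have h1 := hjy ⟨e δ j, ⟨j, rfl⟩, hmem⟩
    set j' := jy ⟨e δ j, ⟨j, rfl⟩, hmem⟩ with hj'
    have h2 : j' < j₀ := hj₀ _ ⟨_, rfl⟩
    have h3 : e δ j' ≤ c j' := not_lt.1 fun hlt => by
      obtain ⟨i, hi, hle⟩ := (hc j').2 _ hlt
      exact absurd (hcm hi) (not_lt.2 hle)
    exact absurd h1 (h3.trans_lt ((hcm h2).trans ((hc j).1 _ hjj))).ne
  · have : ∀ y : Y, ∃ j, e δ j = y := fun y => (hY y.2).1
    choose jy hjy using this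
    obtain ⟨j₀, hj₀⟩ := hJ.exists_gt (Set.range jy) (mk_range_le.trans_lt hYν)
    exact ⟨j₀, fun y hy => ⟨jy ⟨y, hy⟩, hj₀ _ ⟨_, rfl⟩, hjy ⟨y, hy⟩⟩⟩

/-- An injection of the finite sequences such that extending a sequence increases its value. -/
structure IsTreeCode {M : Type u} (a : List M → K) : Prop where
  inj : Function.Injective a
  lt_cons : ∀ x s, a s < a (x :: s)

/-- Order the sequences by length first; this well-order has fewer elements than `X`, hence embeds
in it. -/
theorem exists_isTreeCode {M : Type u} {X : Set K} (hM : max ℵ₀ #(List M) < #X) :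
    ∃ a : List M → K, IsTreeCode a ∧ ∀ s, a s ∈ X := by
  let L := (#(List M)).ord.ToType
  obtain ⟨e⟩ : Nonempty (List M ≃ L) := Cardinal.eq.1 (by simp [L])
  have hle : Ordinal.type (α := ℕ ×ₗ L) (· < ·) ≤ Ordinal.type (α := X) (· < ·) := by
    by_contra! h
    have h1 : #X ≤ #(ℕ ×ₗ L) := by
      simpa using Ordinal.card_le_card h.le
    have h2 : #(ℕ ×ₗ L) = ℵ₀ * #(List M) := by
      change #(ℕ × L) = _
      simp [L]
    have h3 : ℵ₀ * #(List M) ≤ max ℵ₀ #(List M) := by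
      simpa using mul_le_max ℵ₀ #(List M)
    exact absurd hM (not_lt.2 ((h1.trans h2.le).trans h3))
  obtain ⟨ι⟩ := Ordinal.type_le_iff'.1 hle
  refine ⟨fun s => ι (toLex (s.length, e s)), ⟨fun s t h => ?_, fun x s => ?_⟩, fun s => (ι _).2⟩
  · have := ι.injective (Subtype.ext h)
    simpa using congrArg (fun z => (ofLex z).2) this
  · exact ι.map_rel_iff.2 (Prod.Lex.toLex_lt_toLex.2 (Or.inl (by simp)))

/-- Club guessing by codes of the tree of finite sequences. -/
theorem exists_guessing_treeCodes {J : Type u} [LinearOrder J] [WellFoundedLT J]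
    {κ ν : Cardinal.{u}} {M : Type u} (hK : IsRegularOrder K κ) (hKκ : #K = κ)
    (hJ : IsRegularOrder J ν) (hJν : #J = ν) (hν : ℵ₀ < ν) (hνκ : ν < κ) (hM : #(List M) < ν) :
    ∃ (I : Type u) (a : I → List M → K), #I ≤ κ ∧ (∀ i, IsTreeCode (a i)) ∧
      ∀ g : K → K, ∃ i, ∀ s, a i s ∈ closurePoints g := by
  obtain ⟨c, hc, hcg⟩ := exists_small_sets hK hJ hJν hν hνκ
  choose pr hpr using exists_greatest_closurePoint (K := K)
  let big (X : Set K) : Prop := ∃ a : List M → K, IsTreeCode a ∧ ∀ s, a s ∈ X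
  have big_mono {X Y : Set K} (h : X ⊆ Y) : big X → big Y := fun ⟨a, ha, haX⟩ =>
    ⟨a, ha, fun s => h (haX s)⟩
  have hbig (g : K → K) : ∃ i, big (c i ∩ closurePoints g) := by
    obtain ⟨δ, X, hX, hνX, hXc⟩ := hcg g
    obtain ⟨a, ha, haX⟩ := exists_isTreeCode (M := M) (X := X) ((max_lt hν hM).trans_le hνX)
    obtain ⟨j, hj⟩ := hXc (Set.range a) (Set.range_subset_iff.2 haX) (mk_range_le.trans_lt hM)
    exact ⟨(δ, j), a, ha, fun s => ⟨hj ⟨s, rfl⟩, hX (haX s)⟩⟩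
  have key : ∃ g₀ : K → K, ∀ g, ∃ i, big (pr g₀ '' c i) ∧ pr g₀ '' c i ⊆ closurePoints g := by
    -- Otherwise each `g₀` is refuted by some `H g₀`. Iterating `ν` times yields shrinking clubs,
    -- and each projection `pr (g j) α` decreases in `j`, hence stabilises.
    by_contra! hno
    choose H hH using hno
    have hsup (j : J) (f : Set.Iio j → K → K) : ∃ g : K → K, ∀ i, f i ≤ g ∧ H (f i) ≤ g := by
      have (x : K) := hK.exists_gt
        ((Set.range fun i => H (f i) x) ∪ Set.range fun i => f i x) <|
          (mk_union_le _ _).trans_lt (add_lt_of_lt (hν.trans hνκ).le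
            (mk_range_le.trans_lt ((hJ.mk_Iio_lt j).trans hνκ))
            (mk_range_le.trans_lt ((hJ.mk_Iio_lt j).trans hνκ)))
      choose g hg using this
      exact ⟨g, fun i => ⟨fun x => (hg x _ (Or.inr ⟨i, rfl⟩)).le,
        fun x => (hg x _ (Or.inl ⟨i, rfl⟩)).le⟩⟩
    choose F hF using hsup
    obtain ⟨g, hg⟩ := exists_wellFounded_recursion F
    have hg' {i j : J} (hij : i < j) : g i ≤ g j ∧ H (g i) ≤ g j := by
      rw [hg j]
      exact hF j (fun i => g i) ⟨i, hij⟩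
    have hgm : Monotone g := fun i j hij => by
      rcases hij.eq_or_lt with rfl | h
      exacts [le_rfl, (hg' h).1]
    have hgb (x : K) := hK.exists_gt (Set.range fun j => g j x)
      (mk_range_le.trans_lt (hJν.trans_lt hνκ))
    choose gs hgs using hgb
    have hgs' (j : J) : g j ≤ gs := fun x => (hgs x _ ⟨j, rfl⟩).le
    obtain ⟨i, hi⟩ := hbig gs
    have : Nonempty J := mk_ne_zero_iff.1 (by rw [hJν]; exact (aleph0_pos.trans hν).ne')
    let m (α : K) : J := Function.argmin fun j => pr (g j) α
    have hm (α : K) (j : J) : pr (g (m α)) α ≤ pr (g j) α :=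
      Function.argmin_le (fun j => pr (g j) α) j
    have hanti (α : K) {j j' : J} (h : j ≤ j') : pr (g j') α ≤ pr (g j) α :=
      (hpr (g j) α).2 ⟨closurePoints_antitone (hgm h) (hpr (g j') α).1.1, (hpr (g j') α).1.2⟩
    -- Since `c i` has fewer than `ν` elements, all its projections have stabilised by `j₀`, so they
    -- lie in the next club as well, which `H (g j₀)` was to prevent.
    obtain ⟨j₀, hj₀⟩ := hJ.exists_gt (m '' c i) (mk_image_le.trans_lt (hc i))
    obtain ⟨j₁, hj₁⟩ := hJ.exists_gt {j₀} (by simpa using one_lt_aleph0.trans hν)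
    have hlt : j₀ < j₁ := hj₁ _ rfl
    refine hH (g j₀) i (big_mono ?_ hi) ?_
    · rintro α ⟨hα, hαg⟩
      exact ⟨α, hα, le_antisymm (hpr (g j₀) α).1.2
        ((hpr (g j₀) α).2 ⟨closurePoints_antitone (hgs' j₀) hαg, le_rfl⟩)⟩
    · rintro _ ⟨α, hα, rfl⟩
      have : pr (g j₀) α = pr (g j₁) α := le_antisymm
        ((hanti α (hj₀ _ ⟨α, hα, rfl⟩).le).trans (hm α j₁)) (hanti α hlt.le)
      rw [this]
      exact closurePoints_antitone (hg' hlt).2 (hpr (g j₁) α).1.1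
  obtain ⟨g₀, hg₀⟩ := key
  refine ⟨{i : K × J // big (pr g₀ '' c i)}, fun i => i.2.choose, ?_, fun i => i.2.choose_spec.1,
    fun g => ?_⟩
  · refine (mk_subtype_le _).trans ?_
    rw [mk_prod, lift_id, lift_id, hKκ, hJν]
    exact (mul_le_max_of_aleph0_le_left (hν.trans hνκ).le).trans (max_le le_rfl hνκ.le)
  · obtain ⟨i, hi, hig⟩ := hg₀ g
    exact ⟨⟨i, hi⟩, fun s => hig (hi.choose_spec.2 s)⟩

end

/-! ### Neighbour rays and locally simple graphs. -/

namespace SimpleGraph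

/-- `r` enumerates a ray in the graph induced on the neighbourhood of `v`. -/
structure IsNeighborRay {V : Type*} (G : SimpleGraph V) (v : V) (r : ℕ → V) : Prop where
  inj : Function.Injective r
  adj_apex : ∀ n, G.Adj v (r n)
  adj_succ : ∀ n, G.Adj (r n) (r (n + 1))

theorem IsNeighborRay.map {V W : Type*} {G : SimpleGraph V} {H : SimpleGraph W} {v : V} {r : ℕ → V}
    (h : G.IsNeighborRay v r) (f : G ↪g H) : H.IsNeighborRay (f v) (f ∘ r) :=
  ⟨f.injective.comp h.inj, fun n => f.map_adj_iff.2 (h.adj_apex n),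
    fun n => f.map_adj_iff.2 (h.adj_succ n)⟩

/-- The subgraph of the neighbourhood traced out by a neighbour ray. -/
theorem IsNeighborRay.exists_subgraph {V : Type u} {G : SimpleGraph V} {v : V} {r : ℕ → V}
    (h : G.IsNeighborRay v r) : ∃ R : (G.induce (G.neighborSet v)).Subgraph, R.IsRay ∧
      ∀ x ∈ R.verts, ∃ n, x.1 = r n := by
  let f : hasse ℕ →g G.induce (G.neighborSet v) :=
    { toFun := fun n => ⟨r n, h.adj_apex n⟩
      map_rel' := by
        rintro a b hab
        rw [hasse_adj, Nat.covBy_iff_add_one_eq, Nat.covBy_iff_add_one_eq] at hab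
        rcases hab with rfl | rfl
        · exact h.adj_succ a
        · exact (h.adj_succ b).symm }
  let c : Copy (hasse ℕ) (G.induce (G.neighborSet v)) :=
    ⟨f, fun a b hab => h.inj (congrArg Subtype.val hab)⟩
  refine ⟨c.toSubgraph, ⟨c.isoToSubgraph⟩, fun x hx => ?_⟩
  simp only [Copy.toSubgraph, Subgraph.map_verts, Subgraph.verts_top, Set.image_univ] at hx
  obtain ⟨n, rfl⟩ := hx
  exact ⟨n, rfl⟩

theorem InClassG.infinite_inter {V : Type u} {G : SimpleGraph V} (hG : G.InClassG) {v : V}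
    {r r' : ℕ → V} (h : G.IsNeighborRay v r) (h' : G.IsNeighborRay v r') :
    {n | ∃ m, r n = r' m}.Infinite := by
  obtain ⟨R, hR, hRr⟩ := h.exists_subgraph
  obtain ⟨R', hR', hRr'⟩ := h'.exists_subgraph
  obtain ⟨T, ⟨hTR, hT, -⟩, hTR', -⟩ := hG v R R' hR hR'
  have (x : T.verts) : ∃ n, (∃ m, r n = r' m) ∧ x.1.1 = r n := by
    obtain ⟨n, hn⟩ := hRr x (hTR.1 x.2)
    obtain ⟨m, hm⟩ := hRr' x (hTR'.1 x.2)
    exact ⟨n, ⟨m, hn.symm.trans hm⟩, hn⟩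
  choose n hn hn' using this
  have := hT.to_subtype
  have hinj : Function.Injective n := fun x y hxy =>
    Subtype.ext (Subtype.ext ((hn' x).trans ((congrArg r hxy).trans (hn' y).symm)))
  exact (Set.infinite_range_of_injective hinj).mono (Set.range_subset_iff.2 hn)

/-- The neighbourhood of each vertex is rayless or a ray. -/
def IsSimpleLocally {V : Type*} (G : SimpleGraph V) : Prop :=
  ∀ v, (∀ r, ¬ G.IsNeighborRay v r) ∨ ∃ t : ℕ → V, Function.Injective t ∧
    (∀ w, G.Adj v w ↔ w ∈ Set.range t) ∧ ∀ m n, G.Adj (t m) (t n) → m + 1 = n ∨ n + 1 = m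

/-- Look at the last time the walk is at most `m`: its next step must go from `m` to `m + 1`. -/
theorem exists_step_of_injective {k : ℕ → ℕ} (hk : Function.Injective k)
    (hs : ∀ n, k n + 1 = k (n + 1) ∨ k (n + 1) + 1 = k n) {m : ℕ} (hm : k 0 ≤ m) :
    ∃ n, k n = m ∧ k (n + 1) = m + 1 := by
  have hfin : {n | k n ≤ m}.Finite := (Set.finite_Iic m).preimage hk.injOn
  obtain ⟨n, hn, hmax⟩ := hfin.exists_maximal ⟨0, hm⟩
  have h1 : ¬ k (n + 1) ≤ m := fun h => by
    have := hmax (y := n + 1) h (Nat.le_succ n)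
    simp at this
  simp only [Set.mem_ofPred_eq] at hn
  rcases hs n with h | h
  · exact ⟨n, by omega, by omega⟩
  · omega

theorem exists_ray_steps {V : Type u} {G : SimpleGraph V} {v : V}
    {R : (G.induce (G.neighborSet v)).Subgraph} (hR : R.IsRay) :
    ∃ r : ℕ → G.neighborSet v, G.IsNeighborRay v (fun n => r n) ∧ (∀ n, r n ∈ R.verts) ∧
      ∀ n, R.Adj (r n) (r (n + 1)) := by
  obtain ⟨e⟩ := hR
  have hadj (n : ℕ) : R.Adj (e n) (e (n + 1)) :=
    e.map_adj_iff.2 (hasse_adj.2 (Or.inl (Order.covBy_add_one n)))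
  exact ⟨fun n => (e n).1, ⟨fun a b hab => e.injective (Subtype.ext (Subtype.ext hab)),
    fun n => (e n).1.2, fun n => (hadj n).adj_sub⟩, fun n => (e n).2, hadj⟩

/-- A ray inside the ray `t` moves by unit steps without repetition, so it traverses every edge of
`t` past its start; any two rays share a tail of `t`. -/
theorem IsSimpleLocally.inClassG {V : Type u} {G : SimpleGraph V} (hG : G.IsSimpleLocally) :
    G.InClassG := by
  intro v R₁ R₂ h₁ h₂
  obtain h | ⟨t, htinj, ht, htadj⟩ := hG v
  · obtain ⟨r, hr, -⟩ := exists_ray_steps h₁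
    exact absurd hr (h _)
  let t' (n : ℕ) : G.neighborSet v := ⟨t n, (ht _).2 ⟨n, rfl⟩⟩
  have key (R : (G.induce (G.neighborSet v)).Subgraph) (hR : R.IsRay) :
      ∃ N, ∀ n ≥ N, R.Adj (t' n) (t' (n + 1)) := by
    obtain ⟨r, hr, hrR, hradj⟩ := exists_ray_steps hR
    have (n : ℕ) : ∃ k, t k = r n := (ht _).1 (r n).2
    choose k hk using this
    have hk' (n : ℕ) : t' (k n) = r n := Subtype.ext (hk n)
    refine ⟨k 0, fun n hn => ?_⟩
    obtain ⟨i, hi, hi'⟩ := exists_step_of_injective (k := k)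
      (fun a b hab => hr.inj ((hk a).symm.trans ((congrArg t hab).trans (hk b))))
      (fun n => htadj _ _ (by rw [hk, hk]; exact hr.adj_succ n)) hn
    rw [← hi, hk', hi, ← hi', hk']
    exact hradj i
  obtain ⟨N₁, hN₁⟩ := key R₁ h₁
  obtain ⟨N₂, hN₂⟩ := key R₂ h₂
  let N := max N₁ N₂
  let T : (G.induce (G.neighborSet v)).Subgraph := (⊤ : Subgraph _).induce (t' '' Set.Ici N)
  have hadjT {n : ℕ} (hn : N ≤ n) : T.Adj (t' n) (t' (n + 1)) :=
    ⟨⟨n, hn, rfl⟩, ⟨n + 1, hn.trans (Nat.le_succ n), rfl⟩,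
      (hN₁ n ((le_max_left _ _).trans hn)).adj_sub⟩
  have hle (R : (G.induce (G.neighborSet v)).Subgraph)
      (hR : ∀ n ≥ N, R.Adj (t' n) (t' (n + 1))) : T ≤ R := by
    refine ⟨?_, ?_⟩
    · rintro _ ⟨n, hn, rfl⟩
      exact (hR n hn).fst_mem
    · rintro _ _ ⟨⟨m, hm, rfl⟩, ⟨n, hn, rfl⟩, h⟩
      rcases htadj m n h with rfl | rfl
      · exact hR m hm
      · exact (hR n hn).symm
  have hinf : T.verts.Infinite := (Set.Ici_infinite N).image
    (fun a _ b _ hab => htinj (congrArg Subtype.val hab))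
  have hconn : T.Connected := by
    have hv (n : ℕ) (hn : N ≤ n) : t' n ∈ T.verts := ⟨n, hn, rfl⟩
    have hreach (n : ℕ) (hn : N ≤ n) : T.coe.Reachable ⟨t' N, hv N le_rfl⟩ ⟨t' n, hv n hn⟩ := by
      induction n, hn using Nat.le_induction with
      | base => exact Reachable.refl _
      | succ n hn ih => exact ih.trans (Adj.reachable (hadjT hn))
    refine ⟨connected_iff_exists_forall_reachable _ |>.2 ⟨⟨t' N, hv N le_rfl⟩, ?_⟩⟩
    rintro ⟨_, n, hn, rfl⟩
    exact hreach n hn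
  exact ⟨T, ⟨hle R₁ fun n hn => hN₁ n ((le_max_left _ _).trans hn), hinf, hconn⟩,
    ⟨hle R₂ fun n hn => hN₂ n ((le_max_right _ _).trans hn), hinf, hconn⟩⟩

/-- Allows padding by isolated vertices up to exactly `κ` vertices. -/
theorem IsSimpleLocally.map {V W : Type*} {G : SimpleGraph V} (hG : G.IsSimpleLocally)
    (f : V ↪ W) : (G.map f).IsSimpleLocally := by
  intro w
  by_cases hw : ∃ v, f v = w
  · obtain ⟨v, rfl⟩ := hw
    obtain h | ⟨t, htinj, ht, htadj⟩ := hG v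
    · refine Or.inl fun r hr => ?_
      have (n : ℕ) : ∃ x, f x = r n := by
        obtain ⟨_, x, _, _, hx⟩ := (map_adj ..).1 (hr.adj_apex n)
        exact ⟨x, hx⟩
      choose s hs using this
      refine h s ⟨fun a b hab => hr.inj (by rw [← hs, ← hs, hab]), fun n => ?_, fun n => ?_⟩
      · have := hr.adj_apex n
        rwa [← hs, map_adj_apply] at this
      · have := hr.adj_succ n
        rwa [← hs, ← hs, map_adj_apply] at this
    · refine Or.inr ⟨f ∘ t, f.injective.comp htinj, fun w => ⟨fun h => ?_, ?_⟩, fun m n h => ?_⟩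
      · obtain ⟨a, x, hax, ha, rfl⟩ := (map_adj ..).1 h
        obtain ⟨n, rfl⟩ := (ht x).1 (f.injective ha ▸ hax)
        exact ⟨n, rfl⟩
      · rintro ⟨n, rfl⟩
        exact map_adj_apply.2 ((ht _).2 ⟨n, rfl⟩)
      · exact htadj m n (map_adj_apply.1 h)
  · refine Or.inl fun r hr => hw ?_
    obtain ⟨x, _, _, hx, _⟩ := (map_adj ..).1 (hr.adj_apex 0)
    exact ⟨x, hx⟩

/-- A lower bound for the complexity of `𝒢_κ` follows from diagonalization over small families. -/
theorem le_complexity_classG {κ c : Cardinal.{u}}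
    (h : ∀ (ι : Type u) (H : ι → SimpleGraph κ.out), #ι < c → (∀ i, (H i).InClassG) →
      ∃ (W : Type u) (G : SimpleGraph W), #W ≤ κ ∧ G.IsSimpleLocally ∧ ∀ i, IsEmpty (G ↪g H i)) :
    c ≤ complexity (classG κ) := by
  refine le_csInf ⟨_, classG κ, subset_rfl, fun s hs => ⟨s, hs, ?_⟩, rfl⟩ ?_
  · obtain ⟨G, -, rfl⟩ := hs
    exact ⟨G, G, rfl, rfl, ⟨Embedding.refl⟩⟩
  rintro _ ⟨D, hDA, hD, rfl⟩
  by_contra! hDc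
  have (t : D) := hDA t.2
  choose H hH hHt using this
  obtain ⟨W, G, hW, hG, hno⟩ := h D H hDc hH
  obtain ⟨f⟩ : Nonempty (W ↪ κ.out) := by
    rw [← Cardinal.le_def, mk_out]
    exact hW
  obtain ⟨t, ht, G', H', hG', hH', ⟨φ⟩⟩ := hD (isoType (G.map f)) ⟨_, (hG.map f).inClassG, rfl⟩
  obtain ⟨e⟩ : Nonempty (G' ≃g G.map f) := Quotient.exact hG'
  obtain ⟨e'⟩ : Nonempty (H' ≃g H ⟨t, ht⟩) := Quotient.exact (hH'.trans (hHt ⟨t, ht⟩).symm)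
  exact (hno ⟨t, ht⟩).false
    (e'.toEmbedding.comp (φ.comp (e.symm.toEmbedding.comp (Embedding.map f G))))

end SimpleGraph

/-! ### The lower bound `κ⁺`. -/

namespace SimpleGraph

section chainCone
variable {A : Type u}

/-- The cone over the tree of finite descending `R`-sequences. -/
def chainCone (R : A → A → Prop) : SimpleGraph (Option (List A)) where
  Adj
    | none, none => False
    | none, some _ => True
    | some _, none => True
    | some l, some m => (m.IsChain R ∧ ∃ a, m = a :: l) ∨ (l.IsChain R ∧ ∃ a, l = a :: m)
  symm := ⟨by
    rintro (_ | l) (_ | m) h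
    exacts [h, trivial, trivial, h.symm]⟩
  loopless := ⟨by
    rintro (_ | l)
    exacts [id, by rintro (⟨-, a, h⟩ | ⟨-, a, h⟩) <;> simpa using congrArg List.length h]⟩

variable {R : A → A → Prop}

theorem chainCone_adj_some {l m : List A} : (chainCone R).Adj (some l) (some m) ↔
    (m.IsChain R ∧ ∃ a, m = a :: l) ∨ (l.IsChain R ∧ ∃ a, l = a :: m) := Iff.rfl

theorem chainCone_adj_none (l : List A) : (chainCone R).Adj none (some l) := trivial

theorem length_of_chainCone_adj {l m : List A} (h : (chainCone R).Adj (some l) (some m)) :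
    m.length = l.length + 1 ∨ l.length = m.length + 1 := by
  rcases h with ⟨-, a, rfl⟩ | ⟨-, a, rfl⟩ <;> simp

/-- All neighbourhoods are rayless. At the apex, a ray must eventually climb the tree forever,
giving an infinite descending chain. At a tree node, parity of lengths forces a ray through the apex
twice. -/
theorem chainCone_isSimpleLocally (hR : WellFounded R) : (chainCone R).IsSimpleLocally := by
  rintro (_ | l) <;> refine Or.inl fun r hr => ?_
  · have (n : ℕ) : ∃ l, r n = some l := by
      have := hr.adj_apex n
      rcases hn : r n with _ | l
      · rw [hn] at this; exact this.elim
      · exact ⟨l, rfl⟩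
    choose l hl using this
    have hadj (n : ℕ) := hr.adj_succ n
    simp only [hl, chainCone_adj_some] at hadj
    have hup : ∃ N, ∃ a, l (N + 1) = a :: l N := by
      by_contra! hno
      have hlen (n : ℕ) : (l (n + 1)).length < (l n).length := by
        obtain ⟨-, a, h⟩ | ⟨-, a, h⟩ := hadj n
        · exact absurd h (hno n a)
        · simp [h]
      have (n : ℕ) : (l n).length + n ≤ (l 0).length := by
        induction n with
        | zero => simp
        | succ n ih => have := hlen n; omega
      have := this ((l 0).length + 1)
      omega
    obtain ⟨N, hN⟩ := hup
    have hall (k : ℕ) : ∃ a, l (N + k + 1) = a :: l (N + k) := by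
      induction k with
      | zero => exact hN
      | succ k ih =>
        obtain ⟨a, ha⟩ := ih
        obtain ⟨-, b, h⟩ | ⟨-, b, h⟩ := hadj (N + k + 1)
        · exact ⟨b, h⟩
        · have : l (N + k) = l (N + k + 1 + 1) := by
            rw [ha] at h; exact (List.cons.inj h).2
          have := hr.inj ((hl _).trans ((congrArg some this).trans (hl _).symm))
          omega
    choose a ha using hall
    refine (wellFounded_iff_isEmpty_descending_chain.1 hR).elim ⟨a, fun k => ?_⟩
    have h2 : l (N + (k + 1) + 1) = a (k + 1) :: a k :: l (N + k) := by
      rw [ha (k + 1), ← add_assoc, ha k]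
    obtain ⟨hc, -⟩ | ⟨-, b, h⟩ := hadj (N + (k + 1))
    · rw [h2] at hc
      exact (List.isChain_cons_cons.1 hc).1
    · have := congrArg List.length h
      rw [ha (k + 1)] at this
      simp at this
      omega
  · have key (n : ℕ) : r n = none ∨ r (n + 1) = none := by
      rcases hn : r n with _ | a
      · exact Or.inl rfl
      rcases hn' : r (n + 1) with _ | b
      · exact Or.inr rfl
      have h1 := hr.adj_apex n
      have h2 := hr.adj_apex (n + 1)
      have h3 := hr.adj_succ n
      rw [hn] at h1 h3
      rw [hn'] at h2 h3
      have := length_of_chainCone_adj h1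
      have := length_of_chainCone_adj h2
      have := length_of_chainCone_adj h3
      omega
    obtain ⟨i, hi, h0⟩ : ∃ i, i < 2 ∧ r i = none := by
      rcases key 0 with h | h
      exacts [⟨0, by simp, h⟩, ⟨1, by simp, h⟩]
    obtain ⟨j, hj, h2⟩ : ∃ j, 2 ≤ j ∧ r j = none := by
      rcases key 2 with h | h
      exacts [⟨2, by simp, h⟩, ⟨3, by simp, h⟩]
    have := hr.inj (h0.trans h2.symm)
    omega

end chainCone

section paths
variable {ι V : Type u} (H : ι → SimpleGraph V)

/-- The relation of one-point extension of finite paths in the neighbourhood of a vertex outside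
of a given set. -/
def PathExt (Z : ι × V → Set V) (q p : (ι × V) × List V) : Prop :=
  q.1 = p.1 ∧ ∃ x, q.2 = x :: p.2 ∧ x ∉ p.2 ∧ (H p.1.1).Adj p.1.2 x ∧ x ∉ Z p.1 ∧
    ∀ y ∈ p.2.head?, (H p.1.1).Adj y x

variable {H}

theorem wellFounded_pathExt {Z : ι × V → Set V}
    (hZ : ∀ p r, (H p.1).IsNeighborRay p.2 r → ∃ n, r n ∈ Z p) : WellFounded (PathExt H Z) := by
  refine wellFounded_iff_isEmpty_descending_chain.2 ⟨fun ⟨f, hf⟩ => ?_⟩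
  choose hf1 x hx hxn hxv hxZ hxa using hf
  have h1 (n : ℕ) : (f n).1 = (f 0).1 := by
    induction n with
    | zero => rfl
    | succ n ih => rw [hf1, ih]
  simp only [h1] at hxv hxZ hxa
  have hmem {m n : ℕ} (h : m < n) : x m ∈ (f n).2 := by
    induction n, h using Nat.le_induction with
    | base => simp [hx]
    | succ n _ ih => simp [hx, ih]
  obtain ⟨n, hn⟩ := hZ (f 0).1 x ⟨fun m n hmn => by
      by_contra hne
      rcases Nat.lt_or_gt_of_ne hne with h | h
      · exact hxn n (hmn ▸ hmem h)
      · exact hxn m (hmn ▸ hmem h), hxv, fun n => hxa (n + 1) _ (by simp [hx])⟩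
  exact hxZ n hn

theorem exists_countable_set_meeting_rays {G : SimpleGraph V} (hG : G.InClassG) (v : V) :
    ∃ Z : Set V, Z.Countable ∧ ∀ r, G.IsNeighborRay v r → ∃ n, r n ∈ Z := by
  by_cases h : ∃ r, G.IsNeighborRay v r
  · obtain ⟨r, hr⟩ := h
    refine ⟨Set.range r, Set.countable_range r, fun s hs => ?_⟩
    obtain ⟨n, m, hm⟩ := (hG.infinite_inter hs hr).nonempty
    exact ⟨n, m, hm.symm⟩
  · exact ⟨∅, Set.countable_empty, fun r hr => absurd ⟨r, hr⟩ h⟩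

/-- The image under `φ` of the path from a child of the root to a node `l`. -/
def imagePath {A : Type u} (φ : Option (List A) → V) : List A → List V
  | [] => []
  | a :: l => φ (some (a :: l)) :: imagePath φ l

theorem exists_of_mem_imagePath {A : Type u} {φ : Option (List A) → V} {l : List A} {x : V}
    (hx : x ∈ imagePath φ l) : ∃ m : List A, x = φ (some m) ∧ m.length ≤ l.length := by
  induction l with
  | nil => simp [imagePath] at hx
  | cons a l ih =>
    rcases List.mem_cons.1 hx with rfl | hx
    · exact ⟨_, rfl, le_rfl⟩
    · obtain ⟨m, hm, hl⟩ := ih hx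
      exact ⟨m, hm, hl.trans (by simp)⟩

/-- A node `(q, k) :: l` is mapped to a path of rank at least that of `q`. Taking for `q` the path
of the root itself gives a path ranked below itself. -/
theorem isEmpty_chainCone_embedding [Uncountable V] {Z : ι × V → Set V}
    (hZc : ∀ p, (Z p).Countable) (hwf : WellFounded (PathExt H Z)) (i : ι) :
    IsEmpty (chainCone (fun a b : ((ι × V) × List V) × V => PathExt H Z a.1 b.1) ↪g H i) := by
  refine ⟨fun φ => ?_⟩
  have : IsWellFounded _ (PathExt H Z) := ⟨hwf⟩
  let A := ((ι × V) × List V) × V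
  let p (l : List A) : (ι × V) × List V := ((i, φ none), imagePath φ l)
  have child (q : (ι × V) × List V) (l : List A)
      (hl : ∀ k : V, ((q, k) :: l).IsChain (fun a b : A => PathExt H Z a.1 b.1)) :
      ∃ k : V, PathExt H Z (p ((q, k) :: l)) (p l) := by
    have hinj : Function.Injective fun k : V => φ (some ((q, k) :: l)) := fun k k' h => by
      simpa using φ.injective h
    -- The uncountably many copies `k` have distinct images, and `Z` is countable.
    obtain ⟨k, hk⟩ : ∃ k : V, φ (some ((q, k) :: l)) ∉ Z (i, φ none) := by
      by_contra! hall
      have : (Set.univ : Set V).Countable :=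
        ((hZc (i, φ none)).preimage hinj).mono fun k _ => hall k
      exact Set.not_countable_univ this
    refine ⟨k, rfl, φ (some ((q, k) :: l)), rfl, fun hmem => ?_,
      φ.map_adj_iff.2 (chainCone_adj_none _), hk, ?_⟩
    · obtain ⟨m, hm, hlen⟩ := exists_of_mem_imagePath hmem
      have := φ.injective hm
      simp only [Option.some.injEq] at this
      subst this
      simp at hlen
    · cases l with
      | nil => simp [p, imagePath]
      | cons a l =>
        simp only [p, imagePath, List.head?_cons, Option.mem_def, Option.some.injEq]
        rintro _ rfl
        exact φ.map_adj_iff.2 (chainCone_adj_some.2 (Or.inl ⟨hl k, _, rfl⟩))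
  have claim (q : (ι × V) × List V) : ∀ (k : V) (l : List A),
      ((q, k) :: l).IsChain (fun a b : A => PathExt H Z a.1 b.1) →
      IsWellFounded.rank (PathExt H Z) q ≤
        IsWellFounded.rank (PathExt H Z) (p ((q, k) :: l)) := by
    induction q using hwf.induction with
    | _ q ih =>
    intro k l hl
    rw [IsWellFounded.rank_eq (PathExt H Z) q]
    refine Ordinal.iSup_le fun ⟨q', hq'⟩ => Order.succ_le_of_lt ?_
    have hl' (k' : V) := List.IsChain.cons_cons (a := ((q', k') : A)) hq' hl
    obtain ⟨k', hk'⟩ := child q' ((q, k) :: l) hl'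
    exact (ih q' hq' k' _ (hl' k')).trans_lt (IsWellFounded.rank_lt_of_rel hk')
  obtain ⟨k, hk⟩ := child (p []) [] fun k => List.isChain_singleton _
  exact absurd (claim (p []) k [] (List.isChain_singleton _))
    (not_le.2 (IsWellFounded.rank_lt_of_rel hk))

end paths

theorem mk_list_le_of_infinite_bound {α : Type u} {κ : Cardinal.{u}} (hκ : ℵ₀ ≤ κ) (h : #α ≤ κ) :
    #(List α) ≤ κ :=
  (mk_list_le_max α).trans (max_le hκ h)

theorem succ_le_complexity_classG {κ : Cardinal.{u}} (hκ : ℵ₀ < κ) :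
    Order.succ κ ≤ complexity (classG κ) := by
  refine le_complexity_classG fun ι H hι hH => ?_
  have : Uncountable κ.out := by rwa [← aleph0_lt_mk_iff, mk_out]
  have := fun p : ι × κ.out => exists_countable_set_meeting_rays (hH p.1) p.2
  choose Z hZc hZ using this
  have hwf := wellFounded_pathExt hZ
  refine ⟨_, _, ?_, chainCone_isSimpleLocally (InvImage.wf Prod.fst hwf),
    isEmpty_chainCone_embedding hZc hwf⟩
  have hmul {a b : Cardinal.{u}} (ha : a ≤ κ) (hb : b ≤ κ) : a * b ≤ κ :=
    (mul_le_mul' ha hb).trans (mul_eq_self hκ.le).le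
  rw [mk_option]
  refine add_le_of_le hκ.le (mk_list_le_of_infinite_bound hκ.le ?_) (one_le_aleph0.trans hκ.le)
  simp only [mk_prod, lift_id, mk_out]
  exact hmul (hmul (hmul (Order.lt_succ_iff.1 hι) le_rfl)
    (mk_list_le_of_infinite_bound hκ.le (mk_out κ).le)) le_rfl

end SimpleGraph

/-! ### The lower bound `μ ^ ℵ₀`. -/

/-- The first `n` terms of a sequence, the last one first. -/
def initialList {α : Type*} (f : ℕ → α) : ℕ → List α
  | 0 => []
  | n + 1 => f n :: initialList f n

@[simp]
theorem length_initialList {α : Type*} (f : ℕ → α) (n : ℕ) : (initialList f n).length = n := by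
  induction n with
  | zero => rfl
  | succ n ih => simp [initialList, ih]

theorem initialList_injective {α : Type*} (f : ℕ → α) : Function.Injective (initialList f) :=
  fun m n h => by simpa using congrArg List.length h

theorem mem_initialList {α : Type*} {f : ℕ → α} {n : ℕ} {x : α} (h : x ∈ initialList f n) :
    ∃ m < n, f m = x := by
  induction n with
  | zero => simp [initialList] at h
  | succ n ih =>
    rcases List.mem_cons.1 h with rfl | h
    · exact ⟨n, by simp, rfl⟩
    · obtain ⟨m, hm, h⟩ := ih h
      exact ⟨m, hm.trans n.lt_succ_self, h⟩

theorem eq_of_initialList_eq {α : Type*} {f g : ℕ → α} {n m : ℕ}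
    (h : initialList f n = initialList g n) (hm : m < n) : f m = g m := by
  induction n with
  | zero => simp at hm
  | succ n ih =>
    obtain ⟨h1, h2⟩ := List.cons.inj h
    rcases (Nat.lt_succ_iff.1 hm).eq_or_lt with rfl | hm
    exacts [h1, ih h2 hm]

namespace SimpleGraph

section branchGraph
variable {K I : Type u}

/-- The tree of finite sequences, with an apex joined to each of the branches `b i`. -/
def branchGraph (b : I → ℕ → K) : SimpleGraph (List K ⊕ I) where
  Adj
    | .inl s, .inl t => (∃ x, t = x :: s) ∨ ∃ x, s = x :: t
    | .inl s, .inr i => ∃ n, s = initialList (b i) (n + 1)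
    | .inr i, .inl s => ∃ n, s = initialList (b i) (n + 1)
    | .inr _, .inr _ => False
  symm := ⟨by
    rintro (s | i) (t | j) h
    exacts [h.symm, h, h, h]⟩
  loopless := ⟨by
    rintro (s | i)
    exacts [by rintro (⟨x, h⟩ | ⟨x, h⟩) <;> simpa using congrArg List.length h, id]⟩

variable {b : I → ℕ → K}

theorem branchGraph_adj_inl_inl {s t : List K} : (branchGraph b).Adj (.inl s) (.inl t) ↔
    (∃ x, t = x :: s) ∨ ∃ x, s = x :: t := Iff.rfl

theorem branchGraph_adj_inl_inr {s : List K} {i : I} : (branchGraph b).Adj (.inl s) (.inr i) ↔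
    ∃ n, s = initialList (b i) (n + 1) := Iff.rfl

theorem branchGraph_adj_inr_inl {s : List K} {i : I} : (branchGraph b).Adj (.inr i) (.inl s) ↔
    ∃ n, s = initialList (b i) (n + 1) := Iff.rfl

theorem not_branchGraph_adj_inr_inr {i j : I} : ¬ (branchGraph b).Adj (.inr i) (.inr j) := id

theorem branchGraph_isNeighborRay (b : I → ℕ → K) (i : I) :
    (branchGraph b).IsNeighborRay (.inr i) fun n => .inl (initialList (b i) (n + 1)) where
  inj m n h := by simpa using initialList_injective _ (Sum.inl_injective h)
  adj_apex n := ⟨n, rfl⟩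
  adj_succ n := Or.inl ⟨_, rfl⟩

/-- The neighbourhood of an apex is its branch. In that of a node `s`, a ray would alternate between
nodes and apices; two nodes around an apex lie on one branch next to `s`, so one is the parent of
`s`, which would recur. -/
theorem branchGraph_isSimpleLocally (b : I → ℕ → K) : (branchGraph b).IsSimpleLocally := by
  rintro (s | i)
  · refine Or.inl fun r hr => ?_
    have parity (n : ℕ) (a c : List K) (ha : r n = .inl a) : r (n + 1) ≠ .inl c := fun hc => by
      have h1 := hr.adj_apex n
      have h2 := hr.adj_apex (n + 1)
      have h3 := hr.adj_succ n
      rw [ha] at h1 h3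
      rw [hc] at h2 h3
      have hlen {s t : List K} (h : (branchGraph b).Adj (.inl s) (.inl t)) :
          t.length = s.length + 1 ∨ s.length = t.length + 1 := by
        rcases h with ⟨x, rfl⟩ | ⟨x, rfl⟩ <;> simp
      have := hlen h1
      have := hlen h2
      have := hlen h3
      omega
    have alt (n : ℕ) (a : List K) (ha : r n = .inl a) :
        ∃ j c, r (n + 1) = .inr j ∧ r (n + 2) = .inl c := by
      rcases hj : r (n + 1) with c | j
      · exact absurd hj (parity n a c ha)
      rcases hc : r (n + 2) with c | k
      · exact ⟨j, c, rfl, rfl⟩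
      · have := hr.adj_succ (n + 1)
        rw [hj, hc] at this
        exact absurd this not_branchGraph_adj_inr_inr
    have parent (n : ℕ) (a : List K) (ha : r n = .inl a) :
        (r n = .inl s.tail ∨ r (n + 2) = .inl s.tail) ∧ ∃ c, r (n + 2) = .inl c := by
      obtain ⟨j, c, hj, hc⟩ := alt n a ha
      refine ⟨?_, c, hc⟩
      have h1 := hr.adj_apex n
      have h2 := hr.adj_apex (n + 2)
      have h3 := hr.adj_succ n
      have h4 := hr.adj_succ (n + 1)
      rw [ha, branchGraph_adj_inl_inl] at h1
      rw [hc, branchGraph_adj_inl_inl] at h2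
      rw [ha, hj, branchGraph_adj_inl_inr] at h3
      rw [hj, hc, branchGraph_adj_inr_inl] at h4
      rcases h1 with ⟨x, hx⟩ | ⟨x, rfl⟩
      swap
      · exact Or.inl ha
      rcases h2 with ⟨y, hy⟩ | ⟨y, rfl⟩
      swap
      · exact Or.inr hc
      obtain ⟨m, hm⟩ := h3
      obtain ⟨m', hm'⟩ := h4
      have e1 := congrArg List.length (hm.symm.trans hx)
      have e2 := congrArg List.length (hm'.symm.trans hy)
      simp only [length_initialList, List.length_cons] at e1 e2
      have hmm : m = m' := by omega
      have hac : a = c := by rw [hm, hm', hmm]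
      have := hr.inj (ha.trans ((congrArg Sum.inl hac).trans hc.symm))
      omega
    obtain ⟨k, a, ha⟩ : ∃ k a, r k = .inl a := by
      rcases h0 : r 0 with a | i
      · exact ⟨0, a, h0⟩
      rcases h1 : r 1 with a | j
      · exact ⟨1, a, h1⟩
      have := hr.adj_succ 0
      rw [h0, h1] at this
      exact absurd this not_branchGraph_adj_inr_inr
    obtain ⟨h1, c, hc⟩ := parent k a ha
    obtain ⟨-, d, hd⟩ := parent (k + 2) c hc
    obtain ⟨h2, -⟩ := parent (k + 2 + 2) d hd
    rcases h1 with h1 | h1 <;> rcases h2 with h2 | h2 <;>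
      · have := hr.inj (h1.trans h2.symm)
        omega
  · refine Or.inr ⟨fun n => .inl (initialList (b i) (n + 1)),
      (branchGraph_isNeighborRay b i).inj, ?_, fun m n h => ?_⟩
    · rintro (s | j)
      · rw [branchGraph_adj_inr_inl]
        simp [eq_comm]
      · simp [not_branchGraph_adj_inr_inr]
    · rw [branchGraph_adj_inl_inl] at h
      rcases h with ⟨x, h⟩ | ⟨x, h⟩ <;>
      · have := congrArg List.length h
        simp at this
        omega

end branchGraph

/-- On the closure points of a suitable function, an injection of the nodes of the tree respects
the position of the nodes of increasing branches. -/
theorem exists_forall_closurePoints_lt_iff {K : Type u} [LinearOrder K] {κ : Cardinal.{u}}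
    (hK : IsRegularOrder K κ) (hκ : ℵ₀ < κ) {φ : List K → K} (hφ : Function.Injective φ) :
    ∃ g : K → K, ∀ α ∈ closurePoints g, ∀ b : ℕ → K, StrictMono b → ∀ n,
      φ (initialList b (n + 1)) < α ↔ b n < α := by
  -- `γ` bounds the images of sequences from entries up to `β`, and the entries of the sequence
  -- mapped to `β`; each half gives one direction.
  have (β : K) : ∃ γ, (∀ s : List K, (∀ x ∈ s, x ≤ β) → φ s < γ) ∧
      ∀ s : List K, φ s = β → ∀ x ∈ s, x < γ := by
    have h1 : #(Set.Iic β) < κ := by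
      rw [← Set.Iio_insert]
      exact mk_insert_le.trans_lt (add_lt_of_lt hκ.le (hK.mk_Iio_lt β) (one_lt_aleph0.trans hκ))
    obtain ⟨γ₁, h₁⟩ := hK.exists_gt (Set.range fun s : List (Set.Iic β) => φ (s.map (↑)))
      (mk_range_le.trans_lt ((mk_list_le_max _).trans_lt (max_lt hκ h1)))
    have h2 : {x | ∃ s, φ s = β ∧ x ∈ s}.Countable := by
      by_cases h : ∃ s, φ s = β
      · obtain ⟨s, hs⟩ := h
        refine s.finite_toSet.countable.mono ?_
        rintro x ⟨t, ht, hx⟩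
        rwa [hφ (ht.trans hs.symm)] at hx
      · convert Set.countable_empty
        ext x
        simp only [Set.mem_ofPred_eq, Set.mem_empty_iff_false, iff_false]
        rintro ⟨s, hs, -⟩
        exact h ⟨s, hs⟩
    obtain ⟨γ₂, h₂⟩ := hK.exists_gt _ ((mk_le_aleph0_iff.2 h2.to_subtype).trans_lt hκ)
    refine ⟨max γ₁ γ₂, fun s hs => lt_max_of_lt_left (h₁ _ ⟨s.attachWith _ hs, ?_⟩),
      fun s hs x hx => lt_max_of_lt_right (h₂ x ⟨s, hs, hx⟩)⟩
    exact congrArg φ (List.attachWith_map_subtype_val _)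
  choose g hg hg' using this
  refine ⟨g, fun α hα b hb n => ⟨fun h => ?_, fun h => (hg (b n) _ fun x hx => ?_).trans (hα _ h)⟩⟩
  · exact (hg' _ _ rfl (b n) (by simp [initialList])).trans (hα _ h)
  · obtain ⟨m, hm, rfl⟩ := mem_initialList hx
    exact hb.monotone (Nat.lt_succ_iff.1 hm)

/-- The positions of two neighbour rays of the same vertex, measured by the values of a tree code
along branches `f` and `f'`, determine the branch. -/
theorem InClassG.branch_unique {V M K : Type u} [LinearOrder K] {G : SimpleGraph V}
    (hG : G.InClassG) {w : V} {e : V → K} {a : List M → K} (ha : Function.Injective a)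
    {f f' : ℕ → M} {r r' : ℕ → V} (hr : G.IsNeighborRay w r) (hr' : G.IsNeighborRay w r')
    (h : ∀ n s, a s ≤ e (r n) ↔ a s ≤ a (initialList f n))
    (h' : ∀ n s, a s ≤ e (r' n) ↔ a s ≤ a (initialList f' n)) : f = f' := by
  funext k
  obtain ⟨n, ⟨m, hnm⟩, hkn⟩ := (hG.infinite_inter hr hr').exists_gt k
  have heq : initialList f n = initialList f' m := ha <| le_antisymm
    ((h' m _).1 (hnm ▸ (h n _).2 le_rfl)) ((h n _).1 (hnm ▸ (h' m _).2 le_rfl))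
  have hlen : n = m := by simpa using congrArg List.length heq
  subst hlen
  exact eq_of_initialList_eq heq hkn

theorem power_aleph0_le_complexity_classG {κ μ : Cardinal.{u}} (hκ : κ.IsRegular) (hμ : ℵ₀ ≤ μ)
    (hμκ : Order.succ μ < κ) (hκμ : κ < μ ^ ℵ₀) : μ ^ ℵ₀ ≤ complexity (classG κ) := by
  refine le_complexity_classG fun ι H hι hH => ?_
  let K := κ.ord.ToType
  let M := μ.out
  have hsucc : (Order.succ μ).IsRegular := isRegular_succ hμ
  have hν : ℵ₀ < Order.succ μ := Order.lt_succ_of_le hμ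
  have hκ0 : ℵ₀ < κ := hν.trans hμκ
  have hK : IsRegularOrder K κ := isRegularOrder_toType hκ
  obtain ⟨I, a, hI, ha, hguess⟩ := exists_guessing_treeCodes (M := M) hK (mk_ord_toType κ)
    (isRegularOrder_toType hsucc) (mk_ord_toType _) hν hμκ
    (Order.lt_succ_of_le (mk_list_le_of_infinite_bound hμ (mk_out μ).le))
  obtain ⟨e⟩ : Nonempty (κ.out ≃ K) := Cardinal.eq.1 (by simp [K])
  have hmono (i : I) (f : ℕ → M) : StrictMono fun n => a i (initialList f n) :=
    strictMono_nat_of_lt_succ fun n => (ha i).lt_cons _ _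
  -- Each triple of a graph, a vertex and a coding excludes at most one `f`, and there are fewer
  -- than `μ ^ ℵ₀` triples.
  obtain ⟨f, hf⟩ : ∃ f : ℕ → M, ∀ p : (ι × κ.out) × I, ¬ ∃ r, (H p.1.1).IsNeighborRay p.1.2 r ∧
      ∀ n s, a p.2 s ≤ e (r n) ↔ a p.2 s ≤ a p.2 (initialList f n) := by
    by_contra! hall
    choose p r hr hpr using hall
    have hinj : Function.Injective p := fun f f' hff => by
      have h1 := hr f
      have h2 := hpr f
      rw [hff] at h1 h2
      exact (hH _).branch_unique (ha _).inj h1 (hr f') h2 (hpr f')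
    have hle := mk_le_of_injective hinj
    have hlt : #((ι × κ.out) × I) < μ ^ ℵ₀ := by
      simp only [mk_prod, lift_id, mk_out]
      have h0 := hκ0.le.trans hκμ.le
      exact mul_lt_of_lt h0 (mul_lt_of_lt h0 hι hκμ) (hI.trans_lt hκμ)
    refine absurd hle (not_le.2 (hlt.trans_eq ?_))
    simp [M]
  refine ⟨_, branchGraph fun i n => a i (initialList f n), ?_, branchGraph_isSimpleLocally _,
    fun k => ⟨fun φ => ?_⟩⟩
  · rw [mk_sum, lift_id, lift_id]
    exact add_le_of_le hκ0.le (mk_list_le_of_infinite_bound hκ0.le (mk_ord_toType κ).le) hI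
  obtain ⟨g, hg⟩ := exists_forall_closurePoints_lt_iff hK hκ0 (φ := fun s => e (φ (.inl s)))
    (e.injective.comp (φ.injective.comp Sum.inl_injective))
  obtain ⟨i, hi⟩ := hguess g
  refine hf ((k, φ (.inr i)), i) ⟨_, (branchGraph_isNeighborRay _ i).map φ, fun n s => ?_⟩
  rw [← not_lt, ← not_lt, not_iff_not]
  exact hg (a i s) (hi s) _ (hmono i f) n

end SimpleGraph

/-- Boundedness is included because `sSup` of an unbounded set of cardinals is `0`. -/
theorem corollary2p5 (κ : Cardinal.{u}) (hreg : κ.IsRegular) (hκ : ℵ₁ < κ) :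
    BddAbove ({Order.succ κ} ∪ {c : Cardinal.{u} | ∃ μ : Cardinal.{u}, Order.succ μ < κ ∧ c = μ ^ ℵ₀}) ∧
    sSup ({Order.succ κ} ∪ {c : Cardinal.{u} | ∃ μ : Cardinal.{u}, Order.succ μ < κ ∧ c = μ ^ ℵ₀}) ≤
      SimpleGraph.complexity (SimpleGraph.classG κ) := by
  have hκ0 : ℵ₀ < κ := aleph0_lt_aleph_one.trans hκ
  have hsucc := SimpleGraph.succ_le_complexity_classG hκ0
  have hub : ∀ c ∈ ({Order.succ κ} ∪
      {c : Cardinal.{u} | ∃ μ : Cardinal.{u}, Order.succ μ < κ ∧ c = μ ^ ℵ₀}),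
      c ≤ SimpleGraph.complexity (SimpleGraph.classG κ) := by
    rintro c (rfl | ⟨μ, hμ, rfl⟩)
    · exact hsucc
    -- Finite `μ` is replaced by `ℵ₀`, which is where `ℵ₁ < κ` enters.
    have hmax : Order.succ (max μ ℵ₀) < κ := by
      rcases le_total μ ℵ₀ with h | h
      · rwa [max_eq_right h, succ_aleph0]
      · rwa [max_eq_left h]
    refine (power_le_power_right (le_max_left μ ℵ₀)).trans ?_
    rcases le_or_gt (max μ ℵ₀ ^ ℵ₀) κ with h | h
    · exact (h.trans (Order.le_succ κ)).trans hsucc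
    · exact SimpleGraph.power_aleph0_le_complexity_classG hreg (le_max_right _ _) hmax h
  exact ⟨⟨_, hub⟩, csSup_le' hub⟩
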